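/- Let $s_j=(j\ \,j+1)$, $1\le j\le n-1$, be the simple transpositions of $S_n$, and let $\Gamma(B_n)$ be the graph with vertex set $S_n$ in which $\sigma$ and $\tau$ are adjacent iff $\sigma=\tau s_j$ for some $j$ (products are composed from right to left). A $6$-cycle of $\Gamma(B_n)$ is called primitive if it is not the concatenation of two $4$-cycles, i.e. if its edge set is not the symmetric difference of the edge sets of two $4$-cycles; it is associated with the pair $s_i,s_{i+1}$ if its edges, read once around from a suitable vertex, are labelled by the word $(s_is_{i+1})^3$. A listing of such a cycle in the $s_i$ direction is a listing $\sigma_1,\dots,\sigma_6$ of its vertices in cyclic order with $\sigma_2=\sigma_1s_i$, $\sigma_3=\sigma_1s_is_{i+1}$, and so on. Fix a base vertex $\sigma_0$. A loop based at $\sigma_0$ is read as a map from the infinite path $0,1,2,\dots$ to $\Gamma(B_n)$ that follows the loop and then stays at $\sigma_0$. Two based loops $f,g$ are $G$-homotopic if for some $N$ there is a map $F$ from the cartesian product of this infinite path with the path $0,\dots,N$ to the vertices of $\Gamma(B_n)$, sending adjacent vertices to adjacent or equal ones, with $F(\cdot,0)=f$, $F(\cdot,N)=g$, $F(0,j)=\sigma_0$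 for all $j$, and $F(m,j)=\sigma_0$ for all $j$ and all sufficiently large $m$. For closed walks $c_1,c_2$ in $\Gamma(B_n)$ write $c_1\simeq_G c_2$ if there are paths (walks, possibly repeating vertices) $P_1,P_2$ from $\sigma_0$ to their initial vertices such that $P_1c_1P_1^{-1}$ and $P_2c_2P_2^{-1}$ are $G$-homotopic. For $6$-cycles write $C_1\simeq_G C_2$ if $c_1\simeq_G c_2$ for some closed walks $c_1,c_2$ going once around $C_1$ and $C_2$. **Theorem.** Let $1\le i\le n-2$, and let $C_1\neq C_2$ be two distinct primitive $6$-cycles in $\Gamma(B_n)$, both associated with the pair $s_i,s_{i+1}$. For listings $\sigma_1,\dots,\sigma_6$ of $C_1$ and $\gamma_1,\dots,\gamma_6$ of $C_2$ in the $s_i$ direction, consider the condition $(*)$ there are $k\ge1$ and simple transpositions $\tau_1,\dots,\tau_k$, each disjoint from $s_i$ and from $s_{i+1}$, such that $\gamma_m=\sigma_m\tau_1\cdots\tau_k$ for all $m=1,\dots,6$. 1. $C_1\simeq_G C_2$ if and only if $(*)$ holds for some listings of $C_1$ and $C_2$ in the $s_i$ direction. 2. If the listings in the $s_i$ direction are chosen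 so that $\sigma_1$ and $\gamma_1$ are the ends of a shortest path from $C_1$ to $C_2$ (their distance is minimal among all distances between a vertex of $C_1$ and a vertex of $C_2$), then $C_1\simeq_G C_2$ if and only if $(*)$ holds for these listings. Moreover, if $c_1$ and $c_2$ are the closed walks around $C_1$ and $C_2$ that follow these listings, then $c_1\simeq_G c_2$ if and only if $(*)$ holds for these listings. -/

import Mathlib

/-- The simple transposition `s_i = (i  i+1)` of `Fin n` (indices start at `0`). -/
def simpleTransposition {n : ℕ} (i : ℕ) (hi : i + 1 < n) : Equiv.Perm (Fin n) :=
  Equiv.swap ⟨i, by omega⟩ ⟨i + 1, hi⟩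

/-- `τ` is one of the simple transpositions `s_0, …, s_{n-2}`. -/
def IsSimpleTransposition {n : ℕ} (τ : Equiv.Perm (Fin n)) : Prop :=
  ∃ (i : ℕ) (hi : i + 1 < n), τ = simpleTransposition i hi

/-- The graph `Γ(B_n)`, the `1`-skeleton of the permutahedron: its vertices are the permutations
of `n` letters, and `σ` and `τ` are adjacent when `σ = τ s_i` for a simple transposition `s_i`
(products are composed from right to left). -/
def permGraph (n : ℕ) : SimpleGraph (Equiv.Perm (Fin n)) where
  Adj σ τ := ∃ s, IsSimpleTransposition s ∧ σ = τ * s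
  symm := ⟨by
    rintro σ τ ⟨s, ⟨i, hi, rfl⟩, h⟩
    refine ⟨_, ⟨i, hi, rfl⟩, ?_⟩
    rw [h, mul_assoc, simpleTransposition, Equiv.swap_mul_self, mul_one]⟩
  loopless := ⟨by
    rintro σ ⟨s, ⟨i, hi, rfl⟩, h⟩
    have h1 : simpleTransposition i hi = 1 := by simpa using h
    have h2 := congrArg (fun e : Equiv.Perm (Fin n) => e ⟨i, by omega⟩) h1
    simp [simpleTransposition] at h2⟩

/-- A map of vertices that sends adjacent vertices to adjacent or equal vertices. -/
def IsGraphMap {V W : Type*} (G : SimpleGraph V) (H : SimpleGraph W) (f : V → W) : Prop :=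
  ∀ ⦃a b : V⦄, G.Adj a b → H.Adj (f a) (f b) ∨ f a = f b

/-- `f` and `g`, two maps from the infinite path `0, 1, 2, …` to `H`, are `G`-homotopic as loops
based at `v₀`: for some `N` there is a graph map from the cartesian product of the infinite path
with the path on `0, …, N` to `H`, with first row `f` and last row `g`, all of whose rows start at
`v₀` and are eventually constant at `v₀`. -/
def GHomotopic {W : Type*} (H : SimpleGraph W) (v₀ : W) (f g : ℕ → W) : Prop :=
  ∃ (N : ℕ) (F : ℕ × Fin (N + 1) → W),
    IsGraphMap (SimpleGraph.boxProd (SimpleGraph.hasse ℕ) (SimpleGraph.pathGraph (N + 1))) H F ∧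
    (∀ m, F (m, 0) = f m) ∧ (∀ m, F (m, Fin.last N) = g m) ∧
    (∀ j, F (0, j) = v₀) ∧ ∃ M, ∀ m, M ≤ m → ∀ j, F (m, j) = v₀

/-- The closed walks `c₁` and `c₂`, each connected to the base vertex `v₀` by a suitable path
`P₁`, `P₂`, give `G`-homotopic based loops `P₁ c₁ P₁⁻¹` and `P₂ c₂ P₂⁻¹`. A closed walk at `v₀` is
read as the map on the infinite path that follows it and then stays at `v₀`. -/
def ClosedWalksGHomotopic {V : Type*} (G : SimpleGraph V) (v₀ : V) {x y : V}
    (c₁ : G.Walk x x) (c₂ : G.Walk y y) : Prop :=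
  ∃ (P₁ : G.Walk v₀ x) (P₂ : G.Walk v₀ y),
    GHomotopic G v₀ ((P₁.append c₁).append P₁.reverse).getVert
      ((P₂.append c₂).append P₂.reverse).getVert

/-- The closed walk `c` goes once around the cycle `C` of length `l`. -/
def GoesAround {V : Type*} {G : SimpleGraph V} (C : G.Subgraph) (l : ℕ) {x : V}
    (c : G.Walk x x) : Prop :=
  c.IsCycle ∧ c.length = l ∧ c.toSubgraph = C

/-- The subgraph `C` is a cycle of length `l`. -/
def IsCycleOfLength {V : Type*} {G : SimpleGraph V} (C : G.Subgraph) (l : ℕ) : Prop :=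
  ∃ (x : V) (c : G.Walk x x), GoesAround C l c

/-- A `6`-cycle that is not the concatenation of two `4`-cycles (the edges that the two `4`-cycles
share cancel). -/
def IsPrimitiveSixCycle {V : Type*} {G : SimpleGraph V} (C : G.Subgraph) : Prop :=
  IsCycleOfLength C 6 ∧
    ¬ ∃ D E : G.Subgraph, IsCycleOfLength D 4 ∧ IsCycleOfLength E 4 ∧
      C.edgeSet = symmDiff D.edgeSet E.edgeSet

/-- The `6`-cycles `C₁` and `C₂` are `G`-homotopic, with respect to the base vertex `v₀`: some
closed walks once around them are, when connected to `v₀` by paths. -/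
def SixCyclesGHomotopic {V : Type*} {G : SimpleGraph V} (v₀ : V) (C₁ C₂ : G.Subgraph) : Prop :=
  ∃ (x y : V) (c₁ : G.Walk x x) (c₂ : G.Walk y y),
    GoesAround C₁ 6 c₁ ∧ GoesAround C₂ 6 c₂ ∧ ClosedWalksGHomotopic G v₀ c₁ c₂

/-- The closed walk `c` goes once around the `6`-cycle `C` in the `s_i` direction: from its first
vertex, its edges are labelled `s_i, s_{i+1}, s_i, s_{i+1}, s_i, s_{i+1}`. -/
def GoesAroundInDirection {n : ℕ} (i : ℕ) (hi : i + 2 < n) (C : (permGraph n).Subgraph)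
    {x : Equiv.Perm (Fin n)} (c : (permGraph n).Walk x x) : Prop :=
  GoesAround C 6 c ∧ ∀ m < 6, c.getVert (m + 1) = c.getVert m *
    (if Even m then simpleTransposition i (by omega) else simpleTransposition (i + 1) (by omega))

/-- The `6`-cycle `C` is associated with the pair `s_i`, `s_{i+1}`: it corresponds to the word
`(s_i s_{i+1})^3`. -/
def IsAssociatedWith {n : ℕ} (i : ℕ) (hi : i + 2 < n) (C : (permGraph n).Subgraph) : Prop :=
  ∃ (x : Equiv.Perm (Fin n)) (c : (permGraph n).Walk x x), GoesAroundInDirection i hi C c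

/-- With `σ_1, …, σ_6` and `γ_1, …, γ_6` the successive vertices of `c₁` and `c₂`, there are
`k ≥ 1` simple transpositions `τ_1, …, τ_k`, all disjoint from `s_i` and `s_{i+1}`, such that
`γ_m = σ_m τ_1 ⋯ τ_k` for all `m`. -/
def DifferByDisjointTranspositions {n : ℕ} (i : ℕ) (hi : i + 2 < n) {x y : Equiv.Perm (Fin n)}
    (c₁ : (permGraph n).Walk x x) (c₂ : (permGraph n).Walk y y) : Prop :=
  ∃ τ : List (Equiv.Perm (Fin n)), 1 ≤ τ.length ∧
    (∀ t ∈ τ, IsSimpleTransposition t ∧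
      t.Disjoint (simpleTransposition i (by omega)) ∧
      t.Disjoint (simpleTransposition (i + 1) (by omega))) ∧
    ∀ m < 6, c₂.getVert m = c₁.getVert m * τ.prod

/-! Give the edge between `σ` and `σ s_k` the type consisting of `k` and the images under `σ` of the
first `k` and the first `k + 2` positions. The type does not depend on the end chosen, and opposite
edges of a square of commuting transpositions share it. Every cell of a homotopy is degenerate or
such a square (`edgeWeight_square`), so the parity of the number of edges of each type is a homotopy
invariant. Parities ignore orientation and cancel connecting paths, so they depend only on the cycle
(`walkWeight_eq_of_sixCyclesGHomotopic`).

On a hexagon for `s_i, s_{i+1}` the three edges labelled `s_i` have three different types. Together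
these determine the images of the first `i` and of the first `i + 3` positions
(`initialImage_of_walkWeight_eq`). If two hexagons starting at `x` and `y` have equal parities, `x⁻¹
y` therefore preserves the cuts around the block `i, i + 1, i + 2`. It splits into one of the six
permutations of the block, which moves along the first hexagon, and simple transpositions disjoint
from `s_i` and `s_{i+1}` (`exists_alternatingProduct_mul_word`). Counting inversions shows that the
block part is trivial when `x` and `y` realize the minimal distance.

Conversely, transpositions that commute with all labels push one hexagon through commuting squares
onto the other (`closedWalksGHomotopic_of_commute`). -/

open Equiv

/-! ### Simple transpositions, inversions and reduced words -/

section Transpositions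

variable {n : ℕ}

theorem simpleTransposition_apply_val (k : ℕ) (hk : k + 1 < n) (x : Fin n) :
    (simpleTransposition k hk x).1 = if x.1 = k then k + 1 else if x.1 = k + 1 then k else x.1 := by
  unfold simpleTransposition
  rw [swap_apply_def]
  simp only [Fin.ext_iff]
  split_ifs <;> rfl

@[simp]
theorem simpleTransposition_mul_self (k : ℕ) (hk : k + 1 < n) :
    simpleTransposition k hk * simpleTransposition k hk = 1 :=
  swap_mul_self _ _

@[simp]
theorem simpleTransposition_inv (k : ℕ) (hk : k + 1 < n) :
    (simpleTransposition k hk)⁻¹ = simpleTransposition k hk :=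
  swap_inv _ _

theorem simpleTransposition_injective {k l : ℕ} {hk : k + 1 < n} {hl : l + 1 < n}
    (h : simpleTransposition k hk = simpleTransposition l hl) : k = l := by
  have h1 := congrArg Fin.val (DFunLike.congr_fun h ⟨k, by omega⟩)
  have h2 := congrArg Fin.val (DFunLike.congr_fun h ⟨k + 1, by omega⟩)
  simp only [simpleTransposition_apply_val] at h1 h2
  split_ifs at h1 h2 <;> omega

theorem sign_simpleTransposition (k : ℕ) (hk : k + 1 < n) :
    Perm.sign (simpleTransposition k hk) = -1 :=
  Perm.sign_swap (by simp)

theorem permGraph_adj_iff {σ τ : Perm (Fin n)} :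
    (permGraph n).Adj σ τ ↔ ∃ (k : ℕ) (hk : k + 1 < n), τ = σ * simpleTransposition k hk := by
  constructor
  · rintro ⟨_, ⟨k, hk, rfl⟩, rfl⟩
    exact ⟨k, hk, by simp [mul_assoc]⟩
  · rintro ⟨k, hk, rfl⟩
    exact ⟨_, ⟨k, hk, rfl⟩, by simp [mul_assoc]⟩

theorem permGraph_adj_mul (σ : Perm (Fin n)) {t : Perm (Fin n)} (ht : IsSimpleTransposition t) :
    (permGraph n).Adj σ (σ * t) := by
  obtain ⟨k, hk, rfl⟩ := ht
  exact permGraph_adj_iff.2 ⟨k, hk, rfl⟩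

theorem sign_eq_neg_of_adj {σ τ : Perm (Fin n)} (h : (permGraph n).Adj σ τ) :
    Perm.sign τ = -Perm.sign σ := by
  obtain ⟨k, hk, rfl⟩ := permGraph_adj_iff.1 h
  simp [sign_simpleTransposition]

/-- The pairs of positions whose entries are out of order. -/
def inversionPairs (σ : Perm (Fin n)) : Finset (Fin n × Fin n) :=
  Finset.univ.filter fun p => p.1 < p.2 ∧ σ p.2 < σ p.1

theorem mem_inversionPairs {σ : Perm (Fin n)} {p : Fin n × Fin n} :
    p ∈ inversionPairs σ ↔ p.1 < p.2 ∧ σ p.2 < σ p.1 := by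
  simp [inversionPairs]

/-- Left multiplication exchanges the values `k` and `k + 1`, so only the pair of positions holding
these two values can change its order. -/
theorem card_inversionPairs_mul_le (k : ℕ) (hk : k + 1 < n) (σ : Perm (Fin n)) :
    (inversionPairs (simpleTransposition k hk * σ)).card ≤ (inversionPairs σ).card + 1 := by
  refine le_trans (Finset.card_le_card (t := insert
    (σ⁻¹ ⟨k, by omega⟩, σ⁻¹ ⟨k + 1, hk⟩) (inversionPairs σ)) ?_) (Finset.card_insert_le _ _)
  rintro ⟨a, b⟩ h
  rw [mem_inversionPairs] at h
  obtain ⟨hab, h⟩ := h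
  simp only [Perm.mul_apply, Fin.lt_def, simpleTransposition_apply_val] at h
  rw [Finset.mem_insert, mem_inversionPairs]
  have hne : (σ a).1 ≠ (σ b).1 := fun h' => hab.ne (σ.injective (Fin.ext h'))
  by_cases hlt : σ b < σ a
  · exact Or.inr ⟨hab, hlt⟩
  · left
    rw [Fin.lt_def] at hlt
    have : (σ a).1 = k ∧ (σ b).1 = k + 1 := by
      split_ifs at h <;> omega
    rw [Prod.mk.injEq, Perm.eq_inv_iff_eq, Perm.eq_inv_iff_eq]
    exact ⟨Fin.ext this.1, Fin.ext this.2⟩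

theorem card_inversionPairs_mul_lt {k : ℕ} (hk : k + 1 < n) {σ : Perm (Fin n)}
    (h : σ⁻¹ ⟨k + 1, hk⟩ < σ⁻¹ ⟨k, by omega⟩) :
    (inversionPairs (simpleTransposition k hk * σ)).card + 1 = (inversionPairs σ).card := by
  refine le_antisymm (Finset.card_lt_card ?_) ?_
  · rw [Finset.ssubset_iff_of_subset]
    · refine ⟨(σ⁻¹ ⟨k + 1, hk⟩, σ⁻¹ ⟨k, by omega⟩), mem_inversionPairs.2 ⟨h, by simp⟩, ?_⟩
      rw [mem_inversionPairs]
      simp [simpleTransposition, swap_apply_left, swap_apply_right, -Fin.val_fin_lt, Fin.lt_def]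
    · rintro ⟨a, b⟩ hab
      rw [mem_inversionPairs] at hab ⊢
      obtain ⟨hab, h'⟩ := hab
      refine ⟨hab, ?_⟩
      simp only [Perm.mul_apply, Fin.lt_def, simpleTransposition_apply_val] at h' ⊢
      have hne : (σ a).1 ≠ (σ b).1 := fun h' => hab.ne (σ.injective (Fin.ext h'))
      by_contra hlt
      have : (σ a).1 = k ∧ (σ b).1 = k + 1 := by
        split_ifs at h' <;> omega
      have ha : a = σ⁻¹ ⟨k, by omega⟩ := Perm.eq_inv_iff_eq.2 (Fin.ext this.1)
      have hb : b = σ⁻¹ ⟨k + 1, hk⟩ := Perm.eq_inv_iff_eq.2 (Fin.ext this.2)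
      exact absurd (show σ⁻¹ _ < σ⁻¹ _ from ha ▸ hb ▸ hab) h.not_gt
  · have := card_inversionPairs_mul_le k hk (simpleTransposition k hk * σ)
    rwa [← mul_assoc, simpleTransposition_mul_self, one_mul] at this

theorem exists_descent {σ : Perm (Fin n)} (h : σ ≠ 1) :
    ∃ (k : ℕ) (hk : k + 1 < n), σ ⟨k + 1, hk⟩ < σ ⟨k, by omega⟩ := by
  by_contra! hcon
  apply h
  cases n with
  | zero => exact Subsingleton.elim _ _
  | succ n =>
    have hmono : StrictMono σ := by
      rw [Fin.strictMono_iff_lt_succ]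
      intro i
      refine lt_of_le_of_ne (hcon i.1 (by omega)) fun h' => ?_
      have := congrArg Fin.val (σ.injective h')
      simp at this
    have := Subsingleton.elim (hmono.orderIsoOfSurjective _ σ.surjective)
      (OrderIso.refl (Fin (n + 1)))
    ext x
    have h2 := DFunLike.congr_fun this x
    simp only [StrictMono.coe_orderIsoOfSurjective, OrderIso.refl_apply] at h2
    simp [h2]

/-- A permutation is a product of as many simple transpositions as it has inversions, and none of
them crosses a cut that the permutation respects. -/
theorem exists_word (P : ℕ → Prop) (σ : Perm (Fin n))
    (hσ : ∀ m, P m → ∀ x, (σ x).1 < m ↔ x.1 < m) :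
    ∃ τ : List (Perm (Fin n)), τ.length = (inversionPairs σ).card ∧ τ.prod = σ ∧
      ∀ t ∈ τ, ∃ (k : ℕ) (hk : k + 1 < n), t = simpleTransposition k hk ∧ ¬ P (k + 1) := by
  induction hN : (inversionPairs σ).card generalizing σ with
  | zero =>
    refine ⟨[], rfl, ?_, by simp⟩
    by_contra hne
    obtain ⟨k, hk, h⟩ := exists_descent (Ne.symm hne)
    rw [Finset.card_eq_zero] at hN
    have : ((⟨k, by omega⟩, ⟨k + 1, hk⟩) : Fin n × Fin n) ∈ inversionPairs σ :=
      mem_inversionPairs.2 ⟨by simp [Fin.lt_def], h⟩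
    simp [hN] at this
  | succ N ih =>
    have hne : σ⁻¹ ≠ 1 := by
      intro h
      rw [inv_eq_one] at h
      subst h
      rw [Finset.card_eq_zero.2] at hN
      · omega
      · ext p
        simp only [mem_inversionPairs, Finset.notMem_empty, iff_false, Perm.one_apply]
        exact fun h => lt_asymm h.1 h.2
    obtain ⟨k, hk, h⟩ := exists_descent hne
    -- A cut at `k + 1` would keep the value `k` to the left of the value `k + 1`, contrary to the
    -- descent of `σ⁻¹`.
    have hP : ¬ P (k + 1) := by
      intro hP
      have h1 := hσ _ hP (σ⁻¹ ⟨k, by omega⟩)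
      have h2 := hσ _ hP (σ⁻¹ ⟨k + 1, hk⟩)
      rw [← Perm.mul_apply, mul_inv_cancel, Perm.one_apply] at h1 h2
      dsimp only at h1 h2
      rw [Fin.lt_def] at h
      omega
    obtain ⟨τ, hlen, hprod, hmem⟩ := ih (simpleTransposition k hk * σ) (by
        intro m hm x
        rw [← hσ m hm x, Perm.mul_apply, simpleTransposition_apply_val]
        have : m ≠ k + 1 := by rintro rfl; exact hP hm
        split_ifs <;> omega) (by
        have := card_inversionPairs_mul_lt hk h
        omega)
    refine ⟨simpleTransposition k hk :: τ, by simp [hlen], ?_, ?_⟩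
    · rw [List.prod_cons, hprod, ← mul_assoc, simpleTransposition_mul_self, one_mul]
    · intro t ht
      rcases List.mem_cons.1 ht with rfl | ht
      · exact ⟨k, hk, rfl, hP⟩
      · exact hmem t ht

theorem exists_walk_of_word {x y : Perm (Fin n)} (τ : List (Perm (Fin n)))
    (hτ : ∀ t ∈ τ, IsSimpleTransposition t) (hxy : y = x * τ.prod) :
    ∃ Q : (permGraph n).Walk x y, Q.length = τ.length ∧
      ∀ p, Q.getVert p = x * (τ.take p).prod := by
  induction τ generalizing x with
  | nil =>
    obtain rfl : y = x := by simpa using hxy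
    exact ⟨SimpleGraph.Walk.nil, by simp, by simp⟩
  | cons t τ ih =>
    obtain ⟨Q, hQ, hv⟩ := ih (x := x * t) (fun t' ht' => hτ t' (List.mem_cons_of_mem _ ht'))
      (by simp [hxy, mul_assoc])
    refine ⟨SimpleGraph.Walk.cons (permGraph_adj_mul x (hτ t (by simp))) Q, by simp [hQ],
      fun p => ?_⟩
    cases p with
    | zero => simp
    | succ p => simp [hv, mul_assoc]

theorem permGraph_walk (x y : Perm (Fin n)) : Nonempty ((permGraph n).Walk x y) := by
  obtain ⟨τ, -, hprod, hmem⟩ := exists_word (fun _ => False) (x⁻¹ * y) (by simp)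
  obtain ⟨Q, -⟩ := exists_walk_of_word (x := x) (y := y) τ (fun t ht => by
    obtain ⟨k, hk, rfl, -⟩ := hmem t ht
    exact ⟨k, hk, rfl⟩) (by simp [hprod])
  exact ⟨Q⟩

/-- Moving the start from `x` to `x s_k` multiplies `x⁻¹ y` on the left by `s_k`, which changes the
number of inversions by at most one. -/
theorem card_inversionPairs_le_length {x y : Perm (Fin n)} (p : (permGraph n).Walk x y) :
    (inversionPairs (x⁻¹ * y)).card ≤ p.length := by
  induction p with
  | nil =>
    rw [inv_mul_cancel, SimpleGraph.Walk.length_nil, Nat.le_zero, Finset.card_eq_zero]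
    ext p
    simp only [mem_inversionPairs, Finset.notMem_empty, iff_false, Perm.one_apply]
    exact fun h => lt_asymm h.1 h.2
  | @cons x z y h p ih =>
    obtain ⟨k, hk, rfl⟩ := permGraph_adj_iff.1 h
    have := card_inversionPairs_mul_le k hk ((x * simpleTransposition k hk)⁻¹ * y)
    rw [mul_inv_rev, simpleTransposition_inv, ← mul_assoc, ← mul_assoc,
      simpleTransposition_mul_self, one_mul] at this
    rw [mul_inv_rev, simpleTransposition_inv] at ih
    rw [SimpleGraph.Walk.length_cons]
    omega

theorem card_inversionPairs_le_dist (x y : Perm (Fin n)) :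
    (inversionPairs (x⁻¹ * y)).card ≤ (permGraph n).dist x y := by
  obtain ⟨p, hp⟩ := SimpleGraph.Reachable.exists_walk_length_eq_dist (permGraph_walk x y)
  exact hp ▸ card_inversionPairs_le_length p

end Transpositions

/-! ### A homotopy invariant: the parity of the number of edges of a given type -/

section EdgeWeight

variable {n : ℕ}

/-- This classifies the nondegenerate 4-cycles: all come from two commuting transpositions. It is
enough to compare both sides on the points that the left side can move. -/
theorem commuting_of_square {k l p q : ℕ} {hk : k + 1 < n} {hl : l + 1 < n} {hp : p + 1 < n}
    {hq : q + 1 < n}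
    (h : simpleTransposition k hk * simpleTransposition p hp =
      simpleTransposition l hl * simpleTransposition q hq)
    (hkl : k ≠ l) (hkp : k ≠ p) : p = l ∧ q = k ∧ l + 1 ≠ k ∧ k + 1 ≠ l := by
  have key : ∀ (x : ℕ) (hx : x < n), _ :=
    fun x hx => congrArg Fin.val (DFunLike.congr_fun h (⟨x, hx⟩ : Fin n))
  simp only [Perm.mul_apply, simpleTransposition_apply_val] at key
  have h1 := key k (by omega)
  have h2 := key (k + 1) (by omega)
  have h3 := key p (by omega)
  have h4 := key (p + 1) (by omega)
  grind

/-- The image of the first `m` positions. -/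
def initialImage (σ : Perm (Fin n)) (m : ℕ) : Set (Fin n) := σ '' {x | x.1 < m}

theorem initialImage_mul_of_ne (σ : Perm (Fin n)) {m l : ℕ} (hl : l + 1 < n) (h : m ≠ l + 1) :
    initialImage (σ * simpleTransposition l hl) m = initialImage σ m := by
  ext v
  simp only [initialImage, Set.mem_image, Set.mem_ofPred_eq, Perm.mul_apply]
  constructor
  · rintro ⟨x, hx, rfl⟩
    refine ⟨simpleTransposition l hl x, ?_, rfl⟩
    rw [simpleTransposition_apply_val]
    split_ifs <;> omega
  · rintro ⟨x, hx, rfl⟩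
    refine ⟨simpleTransposition l hl x, ?_, ?_⟩
    · rw [simpleTransposition_apply_val]
      split_ifs <;> omega
    · rw [← Perm.mul_apply (simpleTransposition l hl), simpleTransposition_mul_self, Perm.one_apply]

/-- The type of the edge `σ — σ s_k`: the number `k` and the images of the positions to the left of
the transposed ones, without and with these. -/
def edgeType (σ : Perm (Fin n)) (k : ℕ) : ℕ × Set (Fin n) × Set (Fin n) :=
  (k, initialImage σ k, initialImage σ (k + 2))

/-- The case `l = k` is allowed and says that the type is independent of the chosen end; the case of
distant `k` and `l` compares opposite edges of a square. -/
theorem edgeType_mul (σ : Perm (Fin n)) {k l : ℕ} (hl : l + 1 < n) (h1 : l + 1 ≠ k)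
    (h2 : k + 1 ≠ l) : edgeType (σ * simpleTransposition l hl) k = edgeType σ k := by
  rw [edgeType, edgeType, initialImage_mul_of_ne _ _ (by omega),
    initialImage_mul_of_ne _ _ (by omega)]

open Classical in
/-- The indicator, modulo `2`, of the edges of type `T`. -/
noncomputable def edgeWeight (T : ℕ × Set (Fin n) × Set (Fin n)) (σ τ : Perm (Fin n)) : ZMod 2 :=
  if ∃ (k : ℕ) (hk : k + 1 < n), τ = σ * simpleTransposition k hk ∧ edgeType σ k = T then 1 else 0

variable (T : ℕ × Set (Fin n) × Set (Fin n))

open Classical in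
theorem edgeWeight_mul (σ : Perm (Fin n)) {k : ℕ} (hk : k + 1 < n) :
    edgeWeight T σ (σ * simpleTransposition k hk) = if edgeType σ k = T then 1 else 0 := by
  unfold edgeWeight
  congr 1
  simp only [mul_right_inj, eq_iff_iff]
  constructor
  · rintro ⟨l, hl, h, h'⟩
    rwa [simpleTransposition_injective h]
  · exact fun h => ⟨k, hk, rfl, h⟩

theorem edgeWeight_self (σ : Perm (Fin n)) : edgeWeight T σ σ = 0 := by
  unfold edgeWeight
  rw [if_neg]
  rintro ⟨k, hk, h, -⟩
  exact (permGraph n).loopless.irrefl σ (permGraph_adj_iff.2 ⟨k, hk, h⟩)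

theorem edgeWeight_comm (σ τ : Perm (Fin n)) : edgeWeight T σ τ = edgeWeight T τ σ := by
  by_cases h : (permGraph n).Adj σ τ
  · obtain ⟨k, hk, rfl⟩ := permGraph_adj_iff.1 h
    have h' := edgeWeight_mul T (σ * simpleTransposition k hk) hk
    rw [mul_assoc, simpleTransposition_mul_self, mul_one,
      edgeType_mul _ _ (by omega) (by omega)] at h'
    rw [edgeWeight_mul, h']
  · unfold edgeWeight
    rw [if_neg, if_neg]
    · rintro ⟨k, hk, h', -⟩
      exact h (permGraph_adj_iff.2 ⟨k, hk, h'⟩).symm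
    · rintro ⟨k, hk, h', -⟩
      exact h (permGraph_adj_iff.2 ⟨k, hk, h'⟩)

theorem edgeWeight_square {a b c d : Perm (Fin n)}
    (hab : (permGraph n).Adj a b ∨ a = b) (hbd : (permGraph n).Adj b d ∨ b = d)
    (hac : (permGraph n).Adj a c ∨ a = c) (hcd : (permGraph n).Adj c d ∨ c = d) :
    edgeWeight T a b + edgeWeight T b d = edgeWeight T a c + edgeWeight T c d := by
  rcases eq_or_ne b c with rfl | hbc
  · rfl
  rcases eq_or_ne a d with rfl | had
  · rw [edgeWeight_comm T b a, edgeWeight_comm T c a, CharTwo.add_self_eq_zero,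
      CharTwo.add_self_eq_zero]
  -- Neighbours have opposite signs, so there are no triangles; this excludes cells with exactly one
  -- collapsed side.
  have hs : ∀ σ τ : Perm (Fin n), (permGraph n).Adj σ τ → Perm.sign τ = -Perm.sign σ :=
    fun _ _ => sign_eq_neg_of_adj
  have hu : ∀ u : ℤˣ, u ≠ -u := by decide
  rcases hab with hab | rfl <;> rcases hbd with hbd | rfl <;> rcases hac with hac | rfl <;>
    rcases hcd with hcd | hcd <;> (try subst hcd) <;>
    first
      | exact absurd rfl had
      | exact absurd rfl hbc
      | simp only [edgeWeight_self, add_zero, zero_add]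
      | skip
  · obtain ⟨k, hk, rfl⟩ := permGraph_adj_iff.1 hab
    obtain ⟨l, hl, rfl⟩ := permGraph_adj_iff.1 hac
    obtain ⟨p, hp, rfl⟩ := permGraph_adj_iff.1 hbd
    obtain ⟨q, hq, h⟩ := permGraph_adj_iff.1 hcd
    have h' := h
    rw [mul_assoc, mul_assoc, mul_right_inj] at h'
    obtain ⟨rfl, rfl, h1, h2⟩ := commuting_of_square h' (by rintro rfl; exact hbc rfl) (by
      rintro rfl
      exact had (by simp [mul_assoc]))
    rw [edgeWeight_mul, edgeWeight_mul, h, edgeWeight_mul, edgeWeight_mul,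
      edgeType_mul _ _ h2 h1, edgeType_mul _ _ h1 h2, add_comm]
  all_goals
    exfalso
    grind

end EdgeWeight

/-! ### Homotopy invariance of the edge parities -/

section WalkWeight

variable {n : ℕ} (T : ℕ × Set (Fin n) × Set (Fin n))

/-- Adding `edgeWeight_square` over the cells of a ladder cancels all inner rungs. Between two rows
of a homotopy the end rungs are constant at the base vertex and weigh `0`. -/
theorem edgeWeight_strip {f g : ℕ → Perm (Fin n)}
    (hf : ∀ m, (permGraph n).Adj (f m) (f (m + 1)) ∨ f m = f (m + 1))
    (hg : ∀ m, (permGraph n).Adj (g m) (g (m + 1)) ∨ g m = g (m + 1))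
    (hfg : ∀ m, (permGraph n).Adj (f m) (g m) ∨ f m = g m) (M : ℕ) :
    (∑ m ∈ Finset.range M, edgeWeight T (f m) (f (m + 1))) + edgeWeight T (f M) (g M) =
      edgeWeight T (f 0) (g 0) + ∑ m ∈ Finset.range M, edgeWeight T (g m) (g (m + 1)) := by
  induction M with
  | zero => simp
  | succ M ih =>
    rw [Finset.sum_range_succ, Finset.sum_range_succ, add_assoc,
      edgeWeight_square T (hf M) (hfg (M + 1)) (hfg M) (hg M), ← add_assoc, ih, add_assoc]

theorem edgeWeight_sum_eq_of_gHomotopic {v₀ : Perm (Fin n)} {f g : ℕ → Perm (Fin n)}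
    (h : GHomotopic (permGraph n) v₀ f g) :
    ∃ M₀, ∀ M, M₀ ≤ M → ∑ m ∈ Finset.range M, edgeWeight T (f m) (f (m + 1)) =
      ∑ m ∈ Finset.range M, edgeWeight T (g m) (g (m + 1)) := by
  obtain ⟨N, F, hF, hf, hg, h0, M₀, hM₀⟩ := h
  refine ⟨M₀, fun M hM => ?_⟩
  have hrow : ∀ j m, (permGraph n).Adj (F (m, j)) (F (m + 1, j)) ∨ F (m, j) = F (m + 1, j) :=
    fun j m => hF (SimpleGraph.boxProd_adj.2 (Or.inl
      ⟨SimpleGraph.hasse_adj.2 (Or.inl (Nat.covBy_iff_add_one_eq.2 rfl)), rfl⟩))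
  have key : ∀ j : Fin (N + 1),
      ∑ m ∈ Finset.range M, edgeWeight T (F (m, j)) (F (m + 1, j)) =
        ∑ m ∈ Finset.range M, edgeWeight T (f m) (f (m + 1)) := by
    intro j
    induction j using Fin.induction with
    | zero => simp only [hf]
    | succ j ih =>
      have hcol : ∀ m, (permGraph n).Adj (F (m, j.castSucc)) (F (m, j.succ)) ∨
          F (m, j.castSucc) = F (m, j.succ) := fun m =>
        hF (SimpleGraph.boxProd_adj.2 (Or.inr
          ⟨SimpleGraph.pathGraph_adj.2 (Or.inl (by simp)), rfl⟩))
      have := edgeWeight_strip T (hrow j.castSucc) (hrow j.succ) hcol M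
      simp only [h0, hM₀ M hM, edgeWeight_self, add_zero, zero_add] at this
      rw [← this, ih]
  rw [← key (Fin.last N)]
  simp only [hg]

/-- The number, modulo `2`, of edges of type `T` on a walk. -/
noncomputable def walkWeight {x y : Perm (Fin n)} (p : (permGraph n).Walk x y) : ZMod 2 :=
  (p.edges.map (Sym2.lift ⟨edgeWeight T, edgeWeight_comm T⟩)).sum

/-- `M` may exceed the length because `getVert` stays at the endpoint and a constant step weighs
`0`. This lets two loops of different lengths be compared over a common range. -/
theorem walkWeight_eq_sum {x y : Perm (Fin n)} (p : (permGraph n).Walk x y) {M : ℕ}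
    (hM : p.length ≤ M) :
    walkWeight T p = ∑ m ∈ Finset.range M, edgeWeight T (p.getVert m) (p.getVert (m + 1)) := by
  induction p generalizing M with
  | nil => simp [walkWeight, edgeWeight_self]
  | @cons x z y h p ih =>
    obtain ⟨M, rfl⟩ : ∃ M', M = M' + 1 := ⟨M - 1, by simp at hM; omega⟩
    rw [Finset.sum_range_succ']
    simp only [SimpleGraph.Walk.getVert_cons_succ, SimpleGraph.Walk.getVert_zero]
    rw [← ih (by simpa using hM)]
    simp [walkWeight, add_comm]

theorem walkWeight_conj {x y : Perm (Fin n)} (P : (permGraph n).Walk x y)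
    (c : (permGraph n).Walk y y) :
    walkWeight T ((P.append c).append P.reverse) = walkWeight T c := by
  simp only [walkWeight, SimpleGraph.Walk.edges_append, SimpleGraph.Walk.edges_reverse,
    List.map_append, List.map_reverse, List.sum_append, List.sum_reverse]
  rw [add_right_comm, CharTwo.add_self_eq_zero, zero_add]

theorem walkWeight_eq_of_closedWalksGHomotopic {v₀ x y : Perm (Fin n)}
    {c₁ : (permGraph n).Walk x x} {c₂ : (permGraph n).Walk y y}
    (h : ClosedWalksGHomotopic (permGraph n) v₀ c₁ c₂) : walkWeight T c₁ = walkWeight T c₂ := by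
  obtain ⟨P₁, P₂, h⟩ := h
  obtain ⟨M₀, hM₀⟩ := edgeWeight_sum_eq_of_gHomotopic T h
  rw [← walkWeight_conj T P₁, ← walkWeight_conj T P₂,
    walkWeight_eq_sum T _ ((le_max_right _ _).trans (le_max_right M₀ _)),
    walkWeight_eq_sum T ((P₂.append c₂).append P₂.reverse)
      ((le_max_left _ _).trans (le_max_right M₀ _))]
  exact hM₀ _ (le_max_left _ _)

/-- Both walks use each edge of `C` exactly once, so neither the starting point nor the direction
matters. -/
theorem walkWeight_eq_of_goesAround {C : (permGraph n).Subgraph} {l : ℕ} {x y : Perm (Fin n)}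
    {c₁ : (permGraph n).Walk x x} {c₂ : (permGraph n).Walk y y}
    (h₁ : GoesAround C l c₁) (h₂ : GoesAround C l c₂) : walkWeight T c₁ = walkWeight T c₂ := by
  refine List.Perm.sum_eq (List.Perm.map _ ?_)
  rw [List.perm_ext_iff_of_nodup h₁.1.isTrail.edges_nodup h₂.1.isTrail.edges_nodup]
  intro e
  rw [← SimpleGraph.Walk.mem_edges_toSubgraph, ← SimpleGraph.Walk.mem_edges_toSubgraph,
    h₁.2.2, h₂.2.2]

theorem walkWeight_eq_of_sixCyclesGHomotopic {v₀ : Perm (Fin n)} {C₁ C₂ : (permGraph n).Subgraph}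
    (h : SixCyclesGHomotopic v₀ C₁ C₂) {x y : Perm (Fin n)}
    {c₁ : (permGraph n).Walk x x} {c₂ : (permGraph n).Walk y y}
    (h₁ : GoesAround C₁ 6 c₁) (h₂ : GoesAround C₂ 6 c₂) : walkWeight T c₁ = walkWeight T c₂ := by
  obtain ⟨_, _, d₁, d₂, hd₁, hd₂, h⟩ := h
  rw [walkWeight_eq_of_goesAround T h₁ hd₁, walkWeight_eq_of_goesAround T h₂ hd₂,
    walkWeight_eq_of_closedWalksGHomotopic T h]

end WalkWeight

/-! ### Hexagons -/

section Hexagon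

variable {n i : ℕ} (hi : i + 2 < n)

/-- The alternating product `s_i s_{i+1} s_i ⋯` with `m` factors. -/
def alternatingProduct : ℕ → Perm (Fin n)
  | 0 => 1
  | m + 1 => alternatingProduct m *
      (if Even m then simpleTransposition i (by omega) else simpleTransposition (i + 1) (by omega))

theorem getVert_eq_mul_alternatingProduct {C : (permGraph n).Subgraph} {x : Perm (Fin n)}
    {c : (permGraph n).Walk x x} (hc : GoesAroundInDirection i hi C c) {m : ℕ} (hm : m ≤ 6) :
    c.getVert m = x * alternatingProduct hi m := by
  induction m with
  | zero => simp [alternatingProduct]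
  | succ m ih => rw [hc.2 m (by omega), ih (by omega), alternatingProduct, mul_assoc]

theorem alternatingProduct_apply_of_notMem (m : ℕ) {z : Fin n} (hz : z.1 < i ∨ i + 3 ≤ z.1) :
    alternatingProduct hi m z = z := by
  induction m with
  | zero => rfl
  | succ m ih =>
    rw [alternatingProduct, Perm.mul_apply]
    convert ih
    ext
    split_ifs <;> rw [simpleTransposition_apply_val] <;> split_ifs <;> omega

theorem initialImage_mul_alternatingProduct (x : Perm (Fin n)) (m : ℕ) {k : ℕ}
    (h1 : k ≠ i + 1) (h2 : k ≠ i + 2) :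
    initialImage (x * alternatingProduct hi m) k = initialImage x k := by
  induction m with
  | zero => simp [alternatingProduct]
  | succ m ih =>
    rw [alternatingProduct, ← mul_assoc]
    split_ifs
    · rw [initialImage_mul_of_ne _ _ h1, ih]
    · rw [initialImage_mul_of_ne _ _ h2, ih]

theorem apply_mem_initialImage (σ : Perm (Fin n)) {m : ℕ} {z : Fin n} :
    σ z ∈ initialImage σ m ↔ z.1 < m := by
  simp [initialImage]

theorem apply_mem_initialImage_mul (σ ρ : Perm (Fin n)) {m : ℕ} {z : Fin n} :
    σ z ∈ initialImage (σ * ρ) m ↔ (ρ⁻¹ z).1 < m := by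
  rw [← apply_mem_initialImage (σ * ρ)]
  simp

theorem initialImage_mono (σ : Perm (Fin n)) {k m : ℕ} (h : k ≤ m) :
    initialImage σ k ⊆ initialImage σ m :=
  Set.image_mono fun _ hx => lt_of_lt_of_le hx h

open Classical in
-- Only the edges leaving at even steps carry the letter `s_i`, and the image of the first `i`
-- positions is constant around the hexagon.
theorem walkWeight_hexagon (A B : Set (Fin n)) {C : (permGraph n).Subgraph} {x : Perm (Fin n)}
    {c : (permGraph n).Walk x x} (hc : GoesAroundInDirection i hi C c) :
    walkWeight (i, A, B) c = ∑ m ∈ {0, 2, 4}, if initialImage x i = A ∧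
      initialImage (x * alternatingProduct hi m) (i + 2) = B then (1 : ZMod 2) else 0 := by
  have hodd : ∀ m < 6, ¬ Even m →
      edgeWeight (i, A, B) (c.getVert m) (c.getVert (m + 1)) = 0 := by
    intro m hm hm'
    rw [hc.2 m hm, if_neg hm', edgeWeight_mul, if_neg]
    simp [edgeType]
  have heven : ∀ m < 6, Even m →
      edgeWeight (i, A, B) (c.getVert m) (c.getVert (m + 1)) = if initialImage x i = A ∧
        initialImage (x * alternatingProduct hi m) (i + 2) = B then (1 : ZMod 2) else 0 := by
    intro m hm hm'
    rw [hc.2 m hm, if_pos hm', edgeWeight_mul,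
      getVert_eq_mul_alternatingProduct hi hc (by omega)]
    simp only [edgeType, Prod.mk.injEq, true_and,
      initialImage_mul_alternatingProduct hi x m (k := i) (by omega) (by omega)]
  rw [walkWeight_eq_sum _ c hc.1.2.1.le]
  simp only [Finset.sum_range_succ, Finset.range_zero, Finset.sum_empty]
  rw [heven 0 (by omega) (by decide), heven 2 (by omega) (by decide),
    heven 4 (by omega) (by decide), hodd 1 (by omega) (by decide), hodd 3 (by omega) (by decide),
    hodd 5 (by omega) (by decide)]
  rw [Finset.sum_insert (by decide), Finset.sum_insert (by decide), Finset.sum_singleton]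
  simp only [zero_add, add_zero, add_assoc]

/-- The alternating products permute `i, i + 1, i + 2` in all six ways. -/
theorem alternatingProduct_apply_val (m : ℕ) (hm : m < 6) :
    (alternatingProduct hi m ⟨i, by omega⟩).1 = i + ![0, 1, 1, 2, 2, 0] ⟨m, hm⟩ ∧
    (alternatingProduct hi m ⟨i + 1, by omega⟩).1 = i + ![1, 0, 2, 1, 0, 2] ⟨m, hm⟩ ∧
    (alternatingProduct hi m ⟨i + 2, by omega⟩).1 = i + ![2, 2, 0, 0, 1, 1] ⟨m, hm⟩ := by
  have s0 : simpleTransposition i (by omega) (⟨i, by omega⟩ : Fin n) = ⟨i + 1, by omega⟩ := by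
    simp [Fin.ext_iff, simpleTransposition_apply_val]
  have s1 : simpleTransposition i (by omega) (⟨i + 1, by omega⟩ : Fin n) = ⟨i, by omega⟩ := by
    simp [Fin.ext_iff, simpleTransposition_apply_val]
  have s2 : simpleTransposition i (by omega) (⟨i + 2, by omega⟩ : Fin n) = ⟨i + 2, by omega⟩ := by
    simp [Fin.ext_iff, simpleTransposition_apply_val]
  have t0 : simpleTransposition (i + 1) (by omega) (⟨i, by omega⟩ : Fin n) = ⟨i, by omega⟩ := by
    simp [Fin.ext_iff, simpleTransposition_apply_val]
    omega
  have t1 : simpleTransposition (i + 1) (by omega) (⟨i + 1, by omega⟩ : Fin n) =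
      ⟨i + 2, by omega⟩ := by
    simp [Fin.ext_iff, simpleTransposition_apply_val]
  have t2 : simpleTransposition (i + 1) (by omega) (⟨i + 2, by omega⟩ : Fin n) =
      ⟨i + 1, by omega⟩ := by
    simp [Fin.ext_iff, simpleTransposition_apply_val]
  interval_cases m <;>
    simp [alternatingProduct, s0, s1, s2, t0, t1, t2, parity_simps]

/-- Within the block, each of the three prefixes omits the image of position `i + 2`. By the table
in `alternatingProduct_apply_val` these omitted values are pairwise different. -/
theorem initialImage_alternatingProduct_ne (x : Perm (Fin n)) {m m' : ℕ}
    (hm : m ∈ ({0, 2, 4} : Finset ℕ)) (hm' : m' ∈ ({0, 2, 4} : Finset ℕ)) (hne : m ≠ m') :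
    initialImage (x * alternatingProduct hi m) (i + 2) ≠
      initialImage (x * alternatingProduct hi m') (i + 2) := by
  intro h
  have hlt : m < 6 := by revert hm; simp; omega
  have hlt' : m' < 6 := by revert hm'; simp; omega
  have h1 : (x * alternatingProduct hi m) ⟨i + 2, by omega⟩ ∉
      initialImage (x * alternatingProduct hi m) (i + 2) := by
    rw [apply_mem_initialImage]
    simp
  rw [h, Perm.mul_apply, apply_mem_initialImage_mul, not_lt] at h1
  set z := (alternatingProduct hi m')⁻¹ (alternatingProduct hi m ⟨i + 2, by omega⟩) with hz
  have hz' : alternatingProduct hi m' z = alternatingProduct hi m ⟨i + 2, by omega⟩ := by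
    simp [hz]
  obtain ⟨-, -, a1⟩ := alternatingProduct_apply_val hi m hlt
  obtain ⟨-, -, a2⟩ := alternatingProduct_apply_val hi m' hlt'
  have hz2 : z = ⟨i + 2, by omega⟩ := by
    by_contra hcon
    have hz3 : i + 3 ≤ z.1 := by
      have : z.1 ≠ i + 2 := fun h => hcon (Fin.ext h)
      omega
    rw [alternatingProduct_apply_of_notMem hi m' (Or.inr hz3)] at hz'
    rw [hz', a1] at hz3
    simp only [Finset.mem_insert, Finset.mem_singleton] at hm
    rcases hm with rfl | rfl | rfl <;> simp at hz3
  rw [hz2] at hz'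
  rw [hz', a1] at a2
  simp only [Finset.mem_insert, Finset.mem_singleton] at hm hm'
  rcases hm with rfl | rfl | rfl <;> rcases hm' with rfl | rfl | rfl <;> simp at a2 hne

variable {C₁ C₂ : (permGraph n).Subgraph} {x y : Perm (Fin n)} {c₁ : (permGraph n).Walk x x}
  {c₂ : (permGraph n).Walk y y}

theorem initialImage_of_walkWeight_eq (h₁ : GoesAroundInDirection i hi C₁ c₁)
    (h₂ : GoesAroundInDirection i hi C₂ c₂) (h : ∀ T, walkWeight T c₁ = walkWeight T c₂) :
    initialImage x i = initialImage y i ∧ initialImage x (i + 3) ⊆ initialImage y (i + 3) := by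
  classical
  have key : ∀ m ∈ ({0, 2, 4} : Finset ℕ), initialImage y i = initialImage x i ∧
      initialImage (x * alternatingProduct hi m) (i + 2) ⊆ initialImage y (i + 3) := by
    intro m hm
    have := h (i, initialImage x i, initialImage (x * alternatingProduct hi m) (i + 2))
    -- The three types on `c₁` are distinct, so each has weight exactly `1`; hence `c₂` also has an
    -- edge of this type.
    rw [walkWeight_hexagon hi _ _ h₁, walkWeight_hexagon hi _ _ h₂,
      Finset.sum_eq_single_of_mem m hm] at this
    · rw [if_pos ⟨rfl, rfl⟩] at this
      obtain ⟨m', -, hm'⟩ := Finset.exists_ne_zero_of_sum_ne_zero (this ▸ one_ne_zero)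
      obtain ⟨e1, e2⟩ := (ite_ne_right_iff.1 hm').1
      refine ⟨e1, ?_⟩
      rw [← e2, ← initialImage_mul_alternatingProduct hi y m' (k := i + 3) (by omega) (by omega)]
      exact initialImage_mono _ (by omega)
    · intro m' hm' hne
      rw [if_neg]
      exact fun h => initialImage_alternatingProduct_ne hi x hm' hm hne h.2
  refine ⟨(key 0 (by simp)).1.symm, ?_⟩
  rintro _ ⟨z, hz, rfl⟩
  rw [Set.mem_ofPred_eq] at hz
  by_cases hz2 : z.1 < i + 2
  · refine (key 0 (by simp)).2 ?_
    simpa [alternatingProduct] using (apply_mem_initialImage x).2 hz2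
  -- The prefix for `m = 0` misses only the position `i + 2`, and `alternatingProduct hi 2` carries
  -- `i + 1` there.
  · refine (key 2 (by simp)).2 ?_
    rw [apply_mem_initialImage_mul]
    have : (alternatingProduct hi 2)⁻¹ z = ⟨i + 1, by omega⟩ := by
      rw [Perm.inv_eq_iff_eq]
      ext
      rw [(alternatingProduct_apply_val hi 2 (by omega)).2.1]
      simp
      omega
    rw [this]
    simp

theorem respects_cuts_of_walkWeight_eq (h₁ : GoesAroundInDirection i hi C₁ c₁)
    (h₂ : GoesAroundInDirection i hi C₂ c₂) (h : ∀ T, walkWeight T c₁ = walkWeight T c₂)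
    (z : Fin n) :
    (((x⁻¹ * y) z).1 < i ↔ z.1 < i) ∧ (((x⁻¹ * y) z).1 < i + 3 ↔ z.1 < i + 3) := by
  obtain ⟨e1, e2⟩ := initialImage_of_walkWeight_eq hi h₁ h₂ h
  have e3 := e2.antisymm (initialImage_of_walkWeight_eq hi h₂ h₁ fun T => (h T).symm).2
  constructor
  · rw [← apply_mem_initialImage x, e1]
    simpa using apply_mem_initialImage y
  · rw [← apply_mem_initialImage x, e3]
    simpa using apply_mem_initialImage y

/-- The columns of the table in `alternatingProduct_apply_val` exhaust the arrangements of three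
letters. -/
theorem exists_fin_six_of_distinct : ∀ a b c : Fin 3, a ≠ b → a ≠ c → b ≠ c → ∃ m : Fin 6,
    a.1 = ![0, 1, 1, 2, 2, 0] m ∧ b.1 = ![1, 0, 2, 1, 0, 2] m ∧ c.1 = ![2, 2, 0, 0, 1, 1] m := by
  decide

/-- A permutation of the positions that respects the cuts before and after `i, i + 1, i + 2` is an
alternating product followed by simple transpositions disjoint from `s_i` and `s_{i+1}`. -/
theorem exists_alternatingProduct_mul_word {ρ : Perm (Fin n)}
    (hρ : ∀ z, ((ρ z).1 < i ↔ z.1 < i) ∧ ((ρ z).1 < i + 3 ↔ z.1 < i + 3)) :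
    ∃ m < 6, ∃ τ : List (Perm (Fin n)), ρ = alternatingProduct hi m * τ.prod ∧
      (∀ t ∈ τ, ∃ (k : ℕ) (hk : k + 1 < n), t = simpleTransposition k hk ∧
        (k + 1 < i ∨ i + 3 ≤ k)) ∧
      (m = 0 ∨ τ.length < (inversionPairs ρ).card) := by
  obtain ⟨m, hm, hmρ⟩ : ∃ m < 6, ∀ z : Fin n, i ≤ z.1 → z.1 < i + 3 →
      alternatingProduct hi m z = ρ z := by
    have hz : ∀ z : Fin n, i ≤ z.1 → z.1 < i + 3 → i ≤ (ρ z).1 ∧ (ρ z).1 < i + 3 := by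
      intro z h1 h2
      have := hρ z
      omega
    have hinj : ∀ z w : Fin n, z.1 ≠ w.1 → (ρ z).1 ≠ (ρ w).1 := fun z w h h' =>
      h (congrArg Fin.val (ρ.injective (Fin.ext h')))
    have b0 := hz ⟨i, by omega⟩ (by simp) (by simp)
    have b1 := hz ⟨i + 1, by omega⟩ (by simp) (by simp)
    have b2 := hz ⟨i + 2, by omega⟩ (by simp) (by simp)
    have d01 := hinj ⟨i, by omega⟩ ⟨i + 1, by omega⟩ (by simp)
    have d02 := hinj ⟨i, by omega⟩ ⟨i + 2, by omega⟩ (by simp)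
    have d12 := hinj ⟨i + 1, by omega⟩ ⟨i + 2, by omega⟩ (by simp)
    obtain ⟨m, hm, e0, e1, e2⟩ : ∃ (m : ℕ) (hm : m < 6),
        (ρ ⟨i, by omega⟩).1 = i + ![0, 1, 1, 2, 2, 0] ⟨m, hm⟩ ∧
        (ρ ⟨i + 1, by omega⟩).1 = i + ![1, 0, 2, 1, 0, 2] ⟨m, hm⟩ ∧
        (ρ ⟨i + 2, by omega⟩).1 = i + ![2, 2, 0, 0, 1, 1] ⟨m, hm⟩ := by
      obtain ⟨⟨m, hm⟩, e⟩ := exists_fin_six_of_distinct ⟨(ρ ⟨i, by omega⟩).1 - i, by omega⟩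
        ⟨(ρ ⟨i + 1, by omega⟩).1 - i, by omega⟩ ⟨(ρ ⟨i + 2, by omega⟩).1 - i, by omega⟩
        (by rw [Ne, Fin.mk.injEq]; omega) (by rw [Ne, Fin.mk.injEq]; omega)
        (by rw [Ne, Fin.mk.injEq]; omega)
      dsimp only at e
      exact ⟨m, hm, by omega⟩
    obtain ⟨f0, f1, f2⟩ := alternatingProduct_apply_val hi m hm
    refine ⟨m, hm, fun z h1 h2 => Fin.ext ?_⟩
    obtain h | h | h : z = ⟨i, by omega⟩ ∨ z = ⟨i + 1, by omega⟩ ∨ z = ⟨i + 2, by omega⟩ := by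
      simp only [Fin.ext_iff]
      omega
    all_goals rw [h]; omega
  -- The quotient `j` fixes the block pointwise and agrees with `ρ` outside it.
  set j := (alternatingProduct hi m)⁻¹ * ρ with hj
  have hjB : ∀ z : Fin n, i ≤ z.1 → z.1 < i + 3 → j z = z := fun z h1 h2 => by
    rw [hj, Perm.mul_apply, ← hmρ z h1 h2, ← Perm.mul_apply, inv_mul_cancel, Perm.one_apply]
  have hjAC : ∀ z : Fin n, z.1 < i ∨ i + 3 ≤ z.1 → j z = ρ z := fun z hz => by
    have := hρ z
    rw [hj, Perm.mul_apply, Perm.inv_eq_iff_eq,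
      alternatingProduct_apply_of_notMem hi m (by omega)]
  -- A letter `s_k` crosses the cut `k + 1`, so respecting the four cuts `i, …, i + 3` excludes
  -- exactly the letters that move a point of the block.
  obtain ⟨τ, hlen, hprod, hmem⟩ := exists_word (fun k => i ≤ k ∧ k ≤ i + 3) j (by
    intro k hk z
    by_cases hz : i ≤ z.1 ∧ z.1 < i + 3
    · rw [hjB z hz.1 hz.2]
    · rw [hjAC z (by omega)]
      have := hρ z
      omega)
  refine ⟨m, hm, τ, by rw [hprod, hj, mul_inv_cancel_left], ?_, ?_⟩
  · intro t ht
    obtain ⟨k, hk, rfl, h⟩ := hmem t ht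
    exact ⟨k, hk, rfl, by omega⟩
  -- Inversions of `j` are inversions of `ρ` with both positions outside the block; if `m ≠ 0`, then
  -- `ρ` has a further one inside it.
  · refine or_iff_not_imp_left.2 fun hm0 => hlen ▸ Finset.card_lt_card ?_
    rw [Finset.ssubset_iff_of_subset]
    · obtain ⟨f0, f1, f2⟩ := alternatingProduct_apply_val hi m hm
      rw [hmρ _ (by simp) (by simp)] at f0 f1 f2
      have : ∃ a b : Fin n, a < b ∧ i ≤ a.1 ∧ b.1 < i + 3 ∧ ρ b < ρ a := by
        by_cases h : ρ ⟨i + 1, by omega⟩ < ρ ⟨i, by omega⟩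
        · exact ⟨_, _, by simp [Fin.lt_def], by simp, by simp, h⟩
        · refine ⟨⟨i + 1, by omega⟩, ⟨i + 2, by omega⟩, by simp [Fin.lt_def], by simp, by simp, ?_⟩
          rw [Fin.lt_def] at h ⊢
          rw [f0, f1] at h
          rw [f1, f2]
          interval_cases m <;> simp at h hm0 ⊢
      obtain ⟨a, b, hab, ha, hb, hlt⟩ := this
      refine ⟨(a, b), mem_inversionPairs.2 ⟨hab, hlt⟩, ?_⟩
      rw [mem_inversionPairs]
      rw [Fin.lt_def] at hab
      rintro ⟨-, h⟩
      dsimp only at h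
      rw [hjB a (by omega) (by omega), hjB b (by omega) (by omega)] at h
      exact absurd hab h.not_gt
    · rintro ⟨a, b⟩ h
      rw [mem_inversionPairs] at h ⊢
      simp only [Fin.lt_def] at h ⊢
      have ha := hρ a
      have hb := hρ b
      by_cases hBa : i ≤ a.1 ∧ a.1 < i + 3
      · rw [hjB a hBa.1 hBa.2] at h
        by_cases hBb : i ≤ b.1 ∧ b.1 < i + 3
        · rw [hjB b hBb.1 hBb.2] at h
          omega
        · rw [hjAC b (by omega)] at h
          omega
      · rw [hjAC a (by omega)] at h
        by_cases hBb : i ≤ b.1 ∧ b.1 < i + 3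
        · rw [hjB b hBb.1 hBb.2] at h
          omega
        · rwa [hjAC b (by omega)] at h

end Hexagon

/-! ### Listings of a hexagon -/

section Listings

variable {n i : ℕ} (hi : i + 2 < n) {C : (permGraph n).Subgraph}

/-- The letter of the edges of a listing in the `s_i` direction with the given parity. -/
def directionLetter (m : ℕ) : Perm (Fin n) :=
  if Even m then simpleTransposition i (by omega) else simpleTransposition (i + 1) (by omega)

theorem getVert_succ_of_goesAround {x y : Perm (Fin n)} {c : (permGraph n).Walk x x}
    {d : (permGraph n).Walk y y} (hc : GoesAroundInDirection i hi C c) (hd : GoesAround C 6 d)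
    {m : ℕ} (hm : m < 6) :
    d.getVert (m + 1) = d.getVert m * directionLetter hi 0 ∨
      d.getVert (m + 1) = d.getVert m * directionLetter hi 1 := by
  have h := d.toSubgraph_adj_getVert (i := m) (by rw [hd.2.1]; exact hm)
  rw [hd.2.2, ← hc.1.2.2, SimpleGraph.Walk.toSubgraph_adj_iff] at h
  obtain ⟨k, hk, hk6⟩ := h
  rw [hc.1.2.1] at hk6
  have hck : c.getVert (k + 1) = c.getVert k * directionLetter hi k := hc.2 k hk6
  have hl : directionLetter hi k = directionLetter hi 0 ∨
      directionLetter hi k = directionLetter hi 1 := by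
    unfold directionLetter
    split_ifs <;> simp_all
  have hsq : directionLetter hi k * directionLetter hi k = 1 := by
    unfold directionLetter
    split_ifs <;> exact simpleTransposition_mul_self _ _
  have : d.getVert (m + 1) = d.getVert m * directionLetter hi k := by
    rcases Sym2.eq_iff.1 hk with ⟨h1, h2⟩ | ⟨h1, h2⟩
    · rw [← h1, ← h2, hck]
    · rw [← h1, ← h2, hck, mul_assoc, hsq, mul_one]
  rcases hl with hl | hl <;> rw [hl] at this
  · exact Or.inl this
  · exact Or.inr this

/-- A cycle never backtracks, whereas two equal consecutive letters would return to the vertex two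
steps before. -/
theorem getVert_succ_alternates {x y : Perm (Fin n)} {c : (permGraph n).Walk x x}
    {d : (permGraph n).Walk y y} (hc : GoesAroundInDirection i hi C c) (hd : GoesAround C 6 d)
    {e : ℕ} (he : d.getVert 1 = d.getVert 0 * directionLetter hi e) {m : ℕ} (hm : m < 6) :
    d.getVert (m + 1) = d.getVert m * directionLetter hi (m + e) := by
  induction m with
  | zero => simpa using he
  | succ m ih =>
    have h1 := ih (by omega)
    have hne := hd.1.getVert_sub_one_ne_getVert_add_one (i := m + 1) (by rw [hd.2.1]; omega)
    rw [Nat.add_sub_cancel] at hne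
    have hcase := getVert_succ_of_goesAround hi hc hd hm
    by_cases hpar : Even (m + e)
    · have hpar' : ¬ Even (m + 1 + e) := by
        rw [add_right_comm, Nat.even_add_one]
        exact not_not.2 hpar
      simp only [directionLetter, hpar, hpar', if_true, if_false, Even.zero, Nat.not_even_one]
        at h1 hcase ⊢
      refine hcase.resolve_left fun h => hne ?_
      rw [h, h1, mul_assoc, simpleTransposition_mul_self, mul_one]
    · have hpar' : Even (m + 1 + e) := by
        rw [add_right_comm, Nat.even_add_one]
        exact hpar
      simp only [directionLetter, hpar, hpar', if_true, if_false, Even.zero, Nat.not_even_one]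
        at h1 hcase ⊢
      refine hcase.resolve_right fun h => hne ?_
      rw [h, h1, mul_assoc, simpleTransposition_mul_self, mul_one]

/-- Every vertex of a hexagon starts a listing in the `s_i` direction. -/
theorem exists_listing_of_mem_support {x v : Perm (Fin n)} {c : (permGraph n).Walk x x}
    (hc : GoesAroundInDirection i hi C c) (hv : v ∈ c.support) :
    ∃ d : (permGraph n).Walk v v, GoesAroundInDirection i hi C d := by
  have hd : GoesAround C 6 (c.rotate v hv) :=
    ⟨hc.1.1.rotate hv, by rw [SimpleGraph.Walk.length_rotate, hc.1.2.1],
      by rw [SimpleGraph.Walk.toSubgraph_rotate, hc.1.2.2]⟩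
  generalize c.rotate v hv = d at hd
  rcases getVert_succ_of_goesAround hi hc hd (m := 0) (by omega) with h | h
  · exact ⟨d, hd, fun m hm => getVert_succ_alternates hi hc hd h hm⟩
  -- A walk of six alternating letters that begins with `s_{i+1}` ends with `s_i`, so its reverse
  -- begins with `s_i`.
  · have hr : GoesAround C 6 d.reverse :=
      ⟨hd.1.reverse, by rw [SimpleGraph.Walk.length_reverse, hd.2.1],
        by rw [SimpleGraph.Walk.toSubgraph_reverse, hd.2.2]⟩
    refine ⟨d.reverse, hr, fun m hm => getVert_succ_alternates hi hc hr (e := 0) ?_ hm⟩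
    have h5 := getVert_succ_alternates hi hc hd h (m := 5) (by omega)
    rw [SimpleGraph.Walk.getVert_reverse, SimpleGraph.Walk.getVert_reverse, hd.2.1]
    simp only [directionLetter, Nat.reduceAdd, Nat.reduceSub, Even.zero, if_true] at h5 ⊢
    rw [if_pos (by decide)] at h5
    rw [h5, mul_assoc, simpleTransposition_mul_self, mul_one]

end Listings

/-! ### The homotopy between two parallel closed walks -/

section Parallel

variable {n : ℕ}

/-- Adjacency up to equality. -/
def AdjOrEq (σ τ : Perm (Fin n)) : Prop := (permGraph n).Adj σ τ ∨ σ = τ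

theorem AdjOrEq.symm {σ τ : Perm (Fin n)} (h : AdjOrEq σ τ) : AdjOrEq τ σ :=
  h.imp SimpleGraph.Adj.symm Eq.symm

theorem take_prod_adjOrEq_succ (x : Perm (Fin n)) {τ : List (Perm (Fin n))}
    (hτ : ∀ t ∈ τ, IsSimpleTransposition t) (p : ℕ) :
    AdjOrEq (x * (τ.take p).prod) (x * (τ.take (p + 1)).prod) := by
  by_cases hp : p < τ.length
  · left
    rw [List.prod_take_succ τ p hp, ← mul_assoc]
    exact permGraph_adj_mul _ (hτ _ (List.getElem_mem hp))
  · right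
    rw [List.take_of_length_le (by omega), List.take_of_length_le (by omega)]

theorem take_prod_adjOrEq (x : Perm (Fin n)) {τ : List (Perm (Fin n))}
    (hτ : ∀ t ∈ τ, IsSimpleTransposition t) {p q : ℕ} (hpq : p ≤ q + 1) (hqp : q ≤ p + 1) :
    AdjOrEq (x * (τ.take p).prod) (x * (τ.take q).prod) := by
  obtain rfl | rfl | rfl : p = q ∨ p = q + 1 ∨ q = p + 1 := by omega
  · exact Or.inr rfl
  · exact AdjOrEq.symm (take_prod_adjOrEq_succ x hτ q)
  · exact take_prod_adjOrEq_succ x hτ p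

theorem getVert_adjOrEq {x y : Perm (Fin n)} (p : (permGraph n).Walk x y) {k l : ℕ}
    (hkl : k ≤ l + 1) (hlk : l ≤ k + 1) : AdjOrEq (p.getVert k) (p.getVert l) := by
  have key : ∀ k, AdjOrEq (p.getVert k) (p.getVert (k + 1)) := by
    intro k
    by_cases hk : k < p.length
    · exact Or.inl (p.adj_getVert_succ hk)
    · right
      rw [p.getVert_of_length_le (by omega), p.getVert_of_length_le (by omega)]
  obtain rfl | rfl | rfl : k = l ∨ k = l + 1 ∨ l = k + 1 := by omega
  · exact Or.inr rfl
  · exact (key l).symm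
  · exact key k

theorem gHomotopic_of_rows {v₀ : Perm (Fin n)} {f g : ℕ → Perm (Fin n)} (N : ℕ)
    (F : ℕ → ℕ → Perm (Fin n)) (hrow : ∀ m, ∀ j ≤ N, AdjOrEq (F m j) (F (m + 1) j))
    (hcol : ∀ m, ∀ j < N, AdjOrEq (F m j) (F m (j + 1)))
    (hf : ∀ m, F m 0 = f m) (hg : ∀ m, F m N = g m) (h0 : ∀ j ≤ N, F 0 j = v₀)
    (M : ℕ) (hM : ∀ m, M ≤ m → ∀ j ≤ N, F m j = v₀) : GHomotopic (permGraph n) v₀ f g := by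
  refine ⟨N, fun p => F p.1 p.2.1, ?_, hf, fun m => hg m, fun j => h0 _ (by omega), M,
    fun m hm j => hM m hm _ (by omega)⟩
  rintro ⟨m, j⟩ ⟨m', j'⟩ h
  rw [SimpleGraph.boxProd_adj] at h
  rcases h with ⟨h, h'⟩ | ⟨h, h'⟩
  · dsimp only at h h'
    subst h'
    rw [SimpleGraph.hasse_adj, Nat.covBy_iff_add_one_eq, Nat.covBy_iff_add_one_eq] at h
    rcases h with rfl | rfl
    · exact hrow _ _ (by omega)
    · exact (hrow _ _ (by omega)).symm
  · dsimp only at h h'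
    subst h'
    rw [SimpleGraph.pathGraph_adj] at h
    have := j.2
    have := j'.2
    dsimp only
    rcases h with h | h
    · rw [← h]
      exact hcol _ _ (by omega)
    · rw [← h]
      exact (hcol _ _ (by omega)).symm

theorem mul_take_prod_adjOrEq {σ u : Perm (Fin n)} {τ : List (Perm (Fin n))}
    (hu : IsSimpleTransposition u) (hτ : ∀ t ∈ τ, Commute t u) (p : ℕ) :
    AdjOrEq (σ * (τ.take p).prod) (σ * u * (τ.take p).prod) := by
  have : Commute (τ.take p).prod u :=
    Commute.list_prod_left _ _ fun t ht => hτ t (List.mem_of_mem_take ht)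
  rw [mul_assoc σ u, ← this.eq, ← mul_assoc]
  exact Or.inl (permGraph_adj_mul _ hu)

/-- If `c₂` is obtained from `c₁` by right multiplication with a product of simple transpositions
that commute with all labels of `c₁`, then `c₁` and `c₂` are `G`-homotopic. -/
theorem closedWalksGHomotopic_of_commute (v₀ : Perm (Fin n)) {x y : Perm (Fin n)}
    (c₁ : (permGraph n).Walk x x) (c₂ : (permGraph n).Walk y y) (hlen : c₂.length = c₁.length)
    (τ : List (Perm (Fin n))) (hτ : ∀ t ∈ τ, IsSimpleTransposition t)
    (hc : ∀ m, c₂.getVert m = c₁.getVert m * τ.prod)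
    (hlab : ∀ m < c₁.length, ∃ u, IsSimpleTransposition u ∧ (∀ t ∈ τ, Commute t u) ∧
      c₁.getVert (m + 1) = c₁.getVert m * u) :
    ClosedWalksGHomotopic (permGraph n) v₀ c₁ c₂ := by
  obtain ⟨P⟩ := permGraph_walk v₀ x
  have hxy : y = x * τ.prod := by simpa using hc 0
  obtain ⟨Q, hQ, hQv⟩ := exists_walk_of_word τ hτ hxy
  -- The second connecting path continues `P` by the walk `Q` that spells `τ` from `x` to `y`.
  refine ⟨P, P.append Q, ?_⟩
  set L := P.length with hL
  set k := τ.length with hk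
  set l := c₁.length with hl
  set f := ((P.append c₁).append P.reverse).getVert with hf
  have hf1 : ∀ m ≤ L, f m = P.getVert m := by
    intro m hm
    rw [hf, SimpleGraph.Walk.getVert_append', if_pos (by simp; omega),
      SimpleGraph.Walk.getVert_append', if_pos hm]
  have hf2 : ∀ m, L ≤ m → m ≤ L + l → f m = c₁.getVert (m - L) := by
    intro m hm hm'
    rw [hf, SimpleGraph.Walk.getVert_append', if_pos (by simp; omega),
      SimpleGraph.Walk.getVert_append, if_neg (by omega)]
  have hf3 : ∀ m, L + l ≤ m → f m = P.getVert (L - (m - (L + l))) := by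
    intro m hm
    rw [hf, SimpleGraph.Walk.getVert_append, if_neg (by simp; omega),
      SimpleGraph.Walk.getVert_reverse]
    simp [← hL, ← hl]
  -- `α` is a time change for `f` with two pauses of length `k`, before and after `c₁`; they make
  -- room for `Q` and its reverse.
  obtain ⟨α, hle, hge, hmono, hstep, a1, a2, a3, a4, a5⟩ : ∃ α : ℕ → ℕ,
      (∀ m, α m ≤ m) ∧ (∀ m, m ≤ α m + 2 * k) ∧ (∀ m, α m ≤ α (m + 1)) ∧
      (∀ m, α (m + 1) ≤ α m + 1) ∧ (∀ m, m ≤ L → α m = m) ∧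
      (∀ m, L ≤ m → m ≤ L + k → α m = L) ∧
      (∀ m, L + k ≤ m → m ≤ L + k + l → α m = m - k) ∧
      (∀ m, L + k + l ≤ m → m ≤ L + 2 * k + l → α m = L + l) ∧
      (∀ m, L + 2 * k + l ≤ m → α m = m - 2 * k) := by
    refine ⟨fun m => m - min k (m - L) - min k (m - (L + k + l)), ?_, ?_, ?_, ?_, ?_, ?_, ?_, ?_,
      ?_⟩ <;> intro m <;> dsimp only <;> omega
  -- With truncated subtraction, `φ` vanishes along `P` and `P.reverse`, rises by one per step in
  -- the first pause, is at least `k` along `c₁`, and falls to `0` in the second pause.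
  set φ : ℕ → ℕ := fun m => min (m - L) (L + 2 * k + l - m) with hφ
  -- Rows up to `2 * k` insert the pauses, as row `j` delays `f` by at most `j`. Row `2 * k + p`
  -- then uses the pauses to walk along the first `p` letters of `τ` and back, and translates `c₁`
  -- by their product.
  refine gHomotopic_of_rows (3 * k)
    (fun m j => f (max (α m) (m - j)) * (τ.take (min (j - 2 * k) (φ m))).prod) ?_ ?_ ?_ ?_ ?_
    (2 * L + 2 * k + l) ?_
  · intro m j hj
    have e1 := hge m
    have e2 := hmono m
    have e3 := hstep m
    by_cases hj2 : j ≤ 2 * k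
    · rw [Nat.sub_eq_zero_of_le hj2]
      simp only [Nat.zero_min, List.take_zero, List.prod_nil, mul_one]
      apply getVert_adjOrEq <;> omega
    · rw [max_eq_left (by omega), max_eq_left (by omega)]
      by_cases hm1 : m < L
      · rw [show φ m = 0 by simp only [hφ]; omega, show φ (m + 1) = 0 by simp only [hφ]; omega]
        simp only [Nat.min_zero, List.take_zero, List.prod_nil, mul_one]
        apply getVert_adjOrEq <;> omega
      by_cases hm2 : m < L + k
      · have e4 := a2 m
        have e5 := a2 (m + 1)
        rw [show α (m + 1) = α m by omega]
        apply take_prod_adjOrEq _ hτ <;> simp only [hφ] <;> omega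
      by_cases hm3 : m < L + k + l
      · have e4 := a3 m
        have e5 := a3 (m + 1)
        rw [show min (j - 2 * k) (φ m) = j - 2 * k by simp only [hφ]; omega,
          show min (j - 2 * k) (φ (m + 1)) = j - 2 * k by simp only [hφ]; omega,
          hf2 (α m) (by omega) (by omega),
          hf2 (α (m + 1)) (by omega) (by omega),
          show α (m + 1) - L = (α m - L) + 1 by omega]
        obtain ⟨u, hu, hτu, h⟩ := hlab (α m - L) (by omega)
        rw [h]
        exact mul_take_prod_adjOrEq hu hτu _
      by_cases hm4 : m < L + 2 * k + l
      · have e4 := a4 m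
        have e5 := a4 (m + 1)
        rw [show α (m + 1) = α m by omega]
        apply take_prod_adjOrEq _ hτ <;> simp only [hφ] <;> omega
      · rw [show φ m = 0 by simp only [hφ]; omega, show φ (m + 1) = 0 by simp only [hφ]; omega]
        simp only [Nat.min_zero, List.take_zero, List.prod_nil, mul_one]
        apply getVert_adjOrEq <;> omega
  · intro m j hj
    have e1 := hge m
    by_cases hj2 : j < 2 * k
    · rw [Nat.sub_eq_zero_of_le hj2.le, Nat.sub_eq_zero_of_le (show j + 1 ≤ 2 * k from hj2)]
      simp only [Nat.zero_min, List.take_zero, List.prod_nil, mul_one]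
      apply getVert_adjOrEq <;> omega
    · rw [max_eq_left (by omega), max_eq_left (by omega)]
      apply take_prod_adjOrEq _ hτ <;> omega
  · intro m
    rw [Nat.sub_zero, max_eq_right (hle m)]
    simp
  · intro m
    have e1 := hge m
    have e2 := a1 m
    have e3 := a2 m
    have e4 := a3 m
    have e5 := a4 m
    have e6 := a5 m
    rw [max_eq_left (by omega), show 3 * k - 2 * k = k by omega]
    have hlr : (P.append Q).length = L + k := by simp [hQ, ← hL]
    by_cases hm3 : m ≤ L + k + l
    · rw [SimpleGraph.Walk.getVert_append', if_pos (by simp [hQ, hlen]; omega),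
        SimpleGraph.Walk.getVert_append']
      by_cases hm2 : m ≤ L + k
      · rw [if_pos (by omega), SimpleGraph.Walk.getVert_append']
        by_cases hm1 : m ≤ L
        · rw [if_pos hm1, show φ m = 0 by simp only [hφ]; omega,
            show α m = m by omega, hf1 m hm1]
          simp
        · rw [if_neg hm1, hQv, show α m = L by omega, hf1 L le_rfl,
            SimpleGraph.Walk.getVert_length,
            show min k (φ m) = m - L by simp only [hφ]; omega]
      · rw [if_neg (by omega), hlr, hc, show min k (φ m) = k by simp only [hφ]; omega,
          List.take_of_length_le le_rfl,
          hf2 _ (by omega) (by omega),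
          show α m - L = m - (L + k) by omega]
    · rw [SimpleGraph.Walk.getVert_append, if_neg (by simp [hQ, hlen]; omega),
        SimpleGraph.Walk.getVert_reverse, SimpleGraph.Walk.length_append (P.append Q), hlr, hlen,
        SimpleGraph.Walk.getVert_append', hf3 _ (by omega)]
      by_cases hm4 : m < L + 2 * k + l
      · rw [if_neg (by omega), hQv, show α m = L + l by omega,
          Nat.sub_self, Nat.sub_zero, hL, SimpleGraph.Walk.getVert_length, ← hL,
          show min k (φ m) = L + k - (m - (L + k + l)) - L by simp only [hφ]; omega]
      · rw [if_pos (by omega), show φ m = 0 by simp only [hφ]; omega,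
          show L - (α m - (L + l)) = L + k - (m - (L + k + l)) by omega]
        simp
  · intro j hj
    rw [show φ 0 = 0 by simp only [hφ]; omega,
      Nat.zero_sub, a1 0 (by omega), max_self, hf1 0 (by omega)]
    simp
  · intro m hm j hj
    have e1 := a5 m
    rw [show φ m = 0 by simp only [hφ]; omega, hf3 _ (by omega),
      show L - (max (α m) (m - j) - (L + l)) = 0 by omega]
    simp

end Parallel

/-! ### From equal parities to disjoint transpositions, and the theorem -/

section Main

variable {n i : ℕ} (hi : i + 2 < n) {C₁ C₂ : (permGraph n).Subgraph}

theorem simpleTransposition_disjoint {k l : ℕ} (hk : k + 1 < n) (hl : l + 1 < n)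
    (h : k + 1 < l ∨ l + 1 < k) :
    (simpleTransposition k hk).Disjoint (simpleTransposition l hl) := by
  intro z
  simp only [Fin.ext_iff, simpleTransposition_apply_val]
  split_ifs <;> omega

theorem closedWalksGHomotopic_of_differByDisjointTranspositions (σ₀ : Perm (Fin n))
    {x y : Perm (Fin n)} {c₁ : (permGraph n).Walk x x} {c₂ : (permGraph n).Walk y y}
    (h₁ : GoesAroundInDirection i hi C₁ c₁) (h₂ : GoesAroundInDirection i hi C₂ c₂)
    (h : DifferByDisjointTranspositions i hi c₁ c₂) :
    ClosedWalksGHomotopic (permGraph n) σ₀ c₁ c₂ := by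
  obtain ⟨τ, -, hτ, hc⟩ := h
  have hl1 := h₁.1.2.1
  have hl2 := h₂.1.2.1
  refine closedWalksGHomotopic_of_commute σ₀ c₁ c₂ (by omega) τ (fun t ht => (hτ t ht).1) ?_ ?_
  · intro m
    by_cases hm : m < 6
    · exact hc m hm
    · rw [c₁.getVert_of_length_le (by omega), c₂.getVert_of_length_le (by omega)]
      simpa using hc 0 (by omega)
  · intro m hm
    refine ⟨_, ?_, ?_, h₁.2 m (by omega)⟩
    · split_ifs
      · exact ⟨i, _, rfl⟩
      · exact ⟨i + 1, _, rfl⟩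
    · intro t ht
      split_ifs
      · exact (hτ t ht).2.1.commute
      · exact (hτ t ht).2.2.commute

/-- If every edge type has the same weight on two listings, then the second hexagon has a listing
that differs by disjoint transpositions from one of the first, and the start of the latter is the
given one or is closer to the second hexagon. -/
theorem exists_differByDisjointTranspositions (hne : C₁ ≠ C₂) {x y : Perm (Fin n)}
    {c₁ : (permGraph n).Walk x x} {c₂ : (permGraph n).Walk y y}
    (h₁ : GoesAroundInDirection i hi C₁ c₁) (h₂ : GoesAroundInDirection i hi C₂ c₂)
    (h : ∀ T, walkWeight T c₁ = walkWeight T c₂) :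
    ∃ v ∈ C₁.verts, (v = x ∨ (permGraph n).dist v y < (permGraph n).dist x y) ∧
      ∀ d : (permGraph n).Walk v v, GoesAroundInDirection i hi C₁ d →
        DifferByDisjointTranspositions i hi d c₂ := by
  obtain ⟨m, hm, τ, hρ, hτ, hdist⟩ := exists_alternatingProduct_mul_word hi
    (respects_cuts_of_walkWeight_eq hi h₁ h₂ h)
  have hy : y = x * alternatingProduct hi m * τ.prod := by
    rw [mul_assoc, ← hρ, mul_inv_cancel_left]
  have hsimple : ∀ t ∈ τ, IsSimpleTransposition t := fun t ht => by
    obtain ⟨k, hk, rfl, -⟩ := hτ t ht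
    exact ⟨k, hk, rfl⟩
  have hdisj : ∀ t ∈ τ, t.Disjoint (simpleTransposition i (by omega)) ∧
      t.Disjoint (simpleTransposition (i + 1) (by omega)) := fun t ht => by
    obtain ⟨k, hk, rfl, h⟩ := hτ t ht
    exact ⟨simpleTransposition_disjoint _ _ (by omega), simpleTransposition_disjoint _ _ (by omega)⟩
  refine ⟨x * alternatingProduct hi m, ?_, ?_, fun d hd => ⟨τ, ?_, fun t ht =>
    ⟨hsimple t ht, hdisj t ht⟩, ?_⟩⟩
  · rw [← getVert_eq_mul_alternatingProduct hi h₁ hm.le, ← h₁.1.2.2,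
      SimpleGraph.Walk.mem_verts_toSubgraph]
    exact c₁.getVert_mem_support m
  · refine hdist.imp (fun h0 => by rw [h0, alternatingProduct, mul_one]) fun hlt => ?_
    obtain ⟨Q, hQ, -⟩ := exists_walk_of_word τ hsimple hy
    calc _ ≤ Q.length := SimpleGraph.dist_le Q
      _ < (inversionPairs (x⁻¹ * y)).card := hQ ▸ hlt
      _ ≤ _ := card_inversionPairs_le_dist x y
  -- If `τ` were empty, both listings would start at the same vertex and spell the same word, so the
  -- hexagons would coincide.
  · rw [Nat.one_le_iff_ne_zero, Ne, List.length_eq_zero_iff]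
    rintro rfl
    rw [List.prod_nil, mul_one] at hy
    subst hy
    refine hne ?_
    rw [← hd.1.2.2, ← h₂.1.2.2]
    congr 1
    refine SimpleGraph.Walk.ext_getVert_le_length (hd.1.2.1.trans h₂.1.2.1.symm) fun k hk => ?_
    rw [hd.1.2.1] at hk
    rw [getVert_eq_mul_alternatingProduct hi hd hk, getVert_eq_mul_alternatingProduct hi h₂ hk]
  · intro k hk
    -- Commutation moves `τ.prod` past the letters of the listing, from its start to its end.
    have hcomm : ∀ k, Commute τ.prod (alternatingProduct hi k) := by
      intro k
      induction k with
      | zero => exact Commute.one_right _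
      | succ k ih =>
        refine ih.mul_right (Commute.list_prod_left _ _ fun t ht => ?_)
        split_ifs
        · exact (hdisj t ht).1.commute
        · exact (hdisj t ht).2.commute
    rw [getVert_eq_mul_alternatingProduct hi hd hk.le,
      getVert_eq_mul_alternatingProduct hi h₂ hk.le, hy, mul_assoc _ τ.prod, (hcomm k).eq,
      mul_assoc, mul_assoc, mul_assoc]

end Main

theorem theorem5p2 (n i : ℕ) (hi : i + 2 < n) (σ₀ : Equiv.Perm (Fin n))
    (C₁ C₂ : (permGraph n).Subgraph)
    (hC₁ : IsPrimitiveSixCycle C₁) (hC₂ : IsPrimitiveSixCycle C₂)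
    (ha₁ : IsAssociatedWith i hi C₁) (ha₂ : IsAssociatedWith i hi C₂)
    (hne : C₁ ≠ C₂) :
    (SixCyclesGHomotopic σ₀ C₁ C₂ ↔
      ∃ (x y : Equiv.Perm (Fin n)) (c₁ : (permGraph n).Walk x x) (c₂ : (permGraph n).Walk y y),
        GoesAroundInDirection i hi C₁ c₁ ∧ GoesAroundInDirection i hi C₂ c₂ ∧
          DifferByDisjointTranspositions i hi c₁ c₂) ∧
    (∀ (x y : Equiv.Perm (Fin n)) (c₁ : (permGraph n).Walk x x) (c₂ : (permGraph n).Walk y y),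
      GoesAroundInDirection i hi C₁ c₁ → GoesAroundInDirection i hi C₂ c₂ →
      (∀ u ∈ C₁.verts, ∀ v ∈ C₂.verts, (permGraph n).dist x y ≤ (permGraph n).dist u v) →
      (SixCyclesGHomotopic σ₀ C₁ C₂ ↔ DifferByDisjointTranspositions i hi c₁ c₂) ∧
      (ClosedWalksGHomotopic (permGraph n) σ₀ c₁ c₂ ↔
        DifferByDisjointTranspositions i hi c₁ c₂)) := by
  have hback : ∀ {x y : Perm (Fin n)} {c₁ : (permGraph n).Walk x x} {c₂ : (permGraph n).Walk y y},
      GoesAroundInDirection i hi C₁ c₁ → GoesAroundInDirection i hi C₂ c₂ →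
      DifferByDisjointTranspositions i hi c₁ c₂ → SixCyclesGHomotopic σ₀ C₁ C₂ :=
    fun h₁ h₂ h => ⟨_, _, _, _, h₁.1, h₂.1,
      closedWalksGHomotopic_of_differByDisjointTranspositions hi σ₀ h₁ h₂ h⟩
  refine ⟨⟨fun h => ?_, ?_⟩, fun x y c₁ c₂ h₁ h₂ hmin => ?_⟩
  · obtain ⟨x, c₁, h₁⟩ := ha₁
    obtain ⟨y, c₂, h₂⟩ := ha₂
    obtain ⟨v, hv, -, hd⟩ := exists_differByDisjointTranspositions hi hne h₁ h₂
      fun T => walkWeight_eq_of_sixCyclesGHomotopic T h h₁.1 h₂.1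
    rw [← h₁.1.2.2, SimpleGraph.Walk.mem_verts_toSubgraph] at hv
    obtain ⟨d, hd'⟩ := exists_listing_of_mem_support hi h₁ hv
    exact ⟨v, y, d, c₂, hd', h₂, hd d hd'⟩
  · rintro ⟨x, y, c₁, c₂, h₁, h₂, h⟩
    exact hback h₁ h₂ h
  · have hforth : SixCyclesGHomotopic σ₀ C₁ C₂ → DifferByDisjointTranspositions i hi c₁ c₂ := by
      intro h
      obtain ⟨v, hv, hvx, hd⟩ := exists_differByDisjointTranspositions hi hne h₁ h₂
        fun T => walkWeight_eq_of_sixCyclesGHomotopic T h h₁.1 h₂.1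
      have hy : y ∈ C₂.verts := by
        rw [← h₂.1.2.2]
        exact c₂.start_mem_verts_toSubgraph
      -- A start `v` closer to `y` than `x` would contradict minimality, so the given listing of
      -- `C₁` already starts at the right vertex.
      obtain rfl := hvx.resolve_right (hmin v hv y hy).not_gt
      exact hd c₁ h₁
    exact ⟨⟨hforth, hback h₁ h₂⟩, fun h => hforth ⟨x, y, c₁, c₂, h₁.1, h₂.1, h⟩,
      closedWalksGHomotopic_of_differByDisjointTranspositions hi σ₀ h₁ h₂⟩
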